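/- A \emph{Mealy automaton} $\mathcal M=(Q,X,\cdot,\circ)$ consists of a finite stateset $Q$, a finite alphabet $X$, a transition function $Q\times X\to Q$, $(q,a)\mapsto q\cdot a$, and a production function $Q\times X\to X$, $(q,a)\mapsto q\circ a$. It is \emph{invertible} if $a\mapsto q\circ a$ is a permutation of $X$ for every $q\in Q$, \emph{reversible} if $q\mapsto q\cdot a$ is a permutation of $Q$ for every $a\in X$, and \emph{bireversible} if it is invertible, reversible and $(q,a)\mapsto(q\cdot a,q\circ a)$ is injective. Its \emph{dual} $\mathfrak d\mathcal M=(X,Q,\circ,\cdot)$ exchanges the roles of $Q$ and $X$: it has stateset $X$, alphabet $Q$, transition $(a,q)\mapsto q\circ a$ and production $(a,q)\mapsto q\cdot a$. If $\mathcal M$ is invertible and reversible, then so is $\mathfrak d\mathcal M$. Let $\mathcal M$ be invertible. A state $q$ acts on the set $X^*$ of finite words by $q\circ(a w)=(q\circ a)\,((q\cdot a)\circ w)$, an automorphism of the regular rooted tree $X^*$; the group generated by these automorphisms is $G(\mathcal M)$, and it also acts on the boundary $X^{\omega}$ (right-infinite words). A word $u=q_1\cdots q_n\in Q^*$ represents the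 element $\pi(u)\in G(\mathcal M)$ that applies $q_1$ first, then $q_2$, and so on. For $\xi\in X^\omega$ let $\mathrm{St}_{G(\mathcal M)}(\xi)$ be the stabilizer of $\xi$ and $\mathrm{St}^+_{G(\mathcal M)}(\xi)=\pi(Q^*)\cap \mathrm{St}_{G(\mathcal M)}(\xi)$. Let $\mathcal P(\mathcal M)$ be the set of positive relations, that is, of nonempty words $u\in Q^*$ with $\pi(u)=1$. The orbital graph $\Gamma(G(\mathcal M),Q,X^\omega,\xi)$ is the (weakly) connected component of $\xi$ in the labelled digraph with vertex set $X^\omega$ and an edge $\eta\to q\circ\eta$ labelled $q$ for every $\eta\in X^\omega$, $q\in Q$. An acyclic multidigraph is one without directed cycles. All these notions are applied to $\mathfrak d\mathcal M$ as well; for $u \in X^*$ we write $\sigma(u)$ for the element of $G(\mathfrak d\mathcal M)$ represented by $u$. \textbf{Theorem.} Let $\mathcal M=(Q,X,\cdot,\circ)$ be a bireversible Mealy automaton such that $G(\mathcal M)$ is infinite and has an element of infinite order. The following are equivalent. (i) $\mathrm{St}_{G(\mathcal M)}(\xi)$ is a torsion group for all $\xi\in X^\omega$. (ii) $\mathcal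 P(\mathfrak d\mathcal M)=\varnothing$ (that is, $\sigma(v)\neq 1$ for every nonempty $v\in X^*$), and the following condition (TS) holds for the dual: for every nonempty word $u\in Q^*$, $$\mathrm{St}^+_{G(\mathfrak d\mathcal M)}(u^\omega)\neq\{1\}\iff \pi(u)^\ell=1\text{ for some }\ell\ge 1.$$ (iii) For every nonempty word $v\in Q^*$, the orbital graph $\Gamma(G(\mathfrak d\mathcal M),X,Q^\omega,v^\omega)$ is either finite or an acyclic multidigraph. -/

import Mathlib

/-! ### Finite and infinite words, automorphisms of the regular rooted tree -/

/-- Right-infinite words over `X`: the boundary of the rooted tree `List X`. -/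
def InfWord (X : Type*) : Type _ := ℕ → X

namespace InfWord

/-- The prefix of length `n` of an infinite word. -/
def pre {X : Type*} (ξ : InfWord X) (n : ℕ) : List X :=
  List.ofFn (fun i : Fin n => ξ i)

/-- The periodic infinite word `v v v ⋯`, for a nonempty finite word `v`. -/
def periodic {X : Type*} (v : List X) (hv : v ≠ []) : InfWord X := fun n =>
  v[n % v.length]'(Nat.mod_lt n (List.length_pos_iff.mpr hv))

@[simp] theorem length_pre {X : Type*} (ξ : InfWord X) (n : ℕ) : (ξ.pre n).length = n := by
  simp [pre]

theorem getElem_pre {X : Type*} (ξ : InfWord X) (n i : ℕ) (h : i < (ξ.pre n).length) :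
    (ξ.pre n)[i] = ξ i := by
  simp [pre]

theorem pre_prefix {X : Type*} (ξ : InfWord X) {m n : ℕ} (h : m ≤ n) :
    ξ.pre m <+: ξ.pre n := by
  have : ξ.pre m = (ξ.pre n).take m := by
    apply List.ext_getElem
    · simp [h]
    · intro i h1 h2
      simp [getElem_pre]
  rw [this]
  exact List.take_prefix _ _

theorem ext_pre {X : Type*} {ξ η : InfWord X} (h : ∀ n, ξ.pre n = η.pre n) : ξ = η := by
  funext n
  have h1 : (ξ.pre (n + 1))[n]'(by simp) = (η.pre (n + 1))[n]'(by simp) := by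
    simp only [h (n + 1)]
  simpa [getElem_pre] using h1

end InfWord

/-- The group of automorphisms of the regular rooted tree with vertex set `List X`: the
permutations of the set of finite words that preserve the length and the prefix relation. -/
def TreeAut (X : Type*) : Subgroup (Equiv.Perm (List X)) where
  carrier := {g | (∀ w, (g w).length = w.length) ∧ ∀ u v, u <+: v ↔ g u <+: g v}
  mul_mem' := by
    rintro g h ⟨hg1, hg2⟩ ⟨hh1, hh2⟩
    refine ⟨fun w => ?_, fun u v => ?_⟩
    · simp [hg1, hh1]
    · rw [hh2, hg2]; rfl
  one_mem' := ⟨fun _ => rfl, fun _ _ => Iff.rfl⟩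
  inv_mem' := by
    rintro g ⟨hg1, hg2⟩
    refine ⟨fun w => ?_, fun u v => ?_⟩
    · have := hg1 (g⁻¹ w)
      simpa using this.symm
    · rw [hg2 (g⁻¹ u) (g⁻¹ v)]
      simp

namespace TreeAut

/-- The action of a tree automorphism on the boundary: the `n`-th letter of `g ∘ ξ` is the last
letter of `g ∘ (ξ 0 ⋯ ξ n)`. -/
def bdry {X : Type*} (g : TreeAut X) (ξ : InfWord X) : InfWord X := fun n =>
  (g.1 (ξ.pre (n + 1)))[n]'(by rw [g.2.1]; simp)

/-- `g ∘ ξ` is the infinite word whose prefixes are the images of the prefixes of `ξ`. -/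
theorem pre_bdry {X : Type*} (g : TreeAut X) (ξ : InfWord X) (n : ℕ) :
    (bdry g ξ).pre n = g.1 (ξ.pre n) := by
  apply List.ext_getElem
  · rw [g.2.1]; simp
  · intro i h1 h2
    rw [InfWord.getElem_pre]
    have hi : i < n := by simpa using h1
    have hp := (g.2.2 _ _).1 (ξ.pre_prefix (Nat.succ_le_of_lt hi))
    exact List.IsPrefix.getElem hp _

instance {X : Type*} : MulAction (TreeAut X) (InfWord X) where
  smul := bdry
  one_smul ξ := InfWord.ext_pre fun n => pre_bdry 1 ξ n
  mul_smul g h ξ := InfWord.ext_pre fun n => by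
    change (bdry (g * h) ξ).pre n = (bdry g (bdry h ξ)).pre n
    rw [pre_bdry, pre_bdry, pre_bdry]
    rfl

end TreeAut

/-! ### Labelled digraphs -/

/-- A digraph (loops and parallel edges with different labels allowed) with vertex set `V` and
edges labelled by `L`: `edge x l y` says that there is an edge `x → y` with label `l`. -/
structure LabelledDigraph (V L : Type*) where
  edge : V → L → V → Prop

namespace LabelledDigraph

variable {V L : Type*}

def Adj (Γ : LabelledDigraph V L) (x y : V) : Prop := ∃ l, Γ.edge x l y

/-- The vertices of the connected component of `y` (ignoring the direction of the edges). -/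
def componentSet (Γ : LabelledDigraph V L) (y : V) : Set V := {x | Relation.EqvGen Γ.Adj y x}

/-- The connected component of `y`. -/
def component (Γ : LabelledDigraph V L) (y : V) : LabelledDigraph (Γ.componentSet y) L where
  edge x l z := Γ.edge x l z

def IsFinite (_ : LabelledDigraph V L) : Prop := Finite V

/-- No vertex has a nonempty directed path to itself. -/
def IsAcyclic (Γ : LabelledDigraph V L) : Prop := ∀ x : V, ¬ Relation.TransGen Γ.Adj x x

end LabelledDigraph

/-! ### Mealy automata -/

/-- A Mealy automaton with stateset `Q` and alphabet `X`. -/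
structure MealyAutomaton (Q X : Type*) where
  /-- the transition function `q · a` -/
  trans : Q → X → Q
  /-- the production function `q ∘ a` -/
  out : Q → X → X

namespace MealyAutomaton

variable {Q X : Type*}

/-- The dual automaton: it has a transition `a --q|p--> b` for each transition `q --a|b--> p`. -/
def dual (M : MealyAutomaton Q X) : MealyAutomaton X Q where
  trans a q := M.out q a
  out a q := M.trans q a

/-- Each state induces a permutation of the alphabet. -/
def Invertible (M : MealyAutomaton Q X) : Prop :=
  ∀ q, Function.Bijective fun a => M.out q a

/-- Each input letter induces a permutation of the stateset. -/
def Reversible (M : MealyAutomaton Q X) : Prop :=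
  ∀ a, Function.Bijective fun q => M.trans q a

/-- Reversible invertible automata. -/
structure IsRI (M : MealyAutomaton Q X) : Prop where
  invertible : M.Invertible
  reversible : M.Reversible

/-- Bireversible automata: moreover each output letter induces a permutation of the stateset, that
is, two different transitions `q --a|b--> p` and `q' --c|b--> p` with the same output letter
and the same target do not exist. -/
structure IsBireversible (M : MealyAutomaton Q X) : Prop extends IsRI M where
  coreversible : ∀ q a q' c, M.trans q a = M.trans q' c → M.out q a = M.out q' c →
    q = q' ∧ a = c

theorem IsRI.dual {M : MealyAutomaton Q X} (h : M.IsRI) : M.dual.IsRI :=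
  ⟨h.reversible, h.invertible⟩

/-- The action of a state on finite words:
`q ∘ (a w) = (q ∘ a) ((q · a) ∘ w)`. -/
def act (M : MealyAutomaton Q X) : Q → List X → List X
  | _, [] => []
  | q, a :: w => M.out q a :: M.act (M.trans q a) w

theorem length_act (M : MealyAutomaton Q X) (q : Q) (w : List X) :
    (M.act q w).length = w.length := by
  induction w generalizing q with
  | nil => rfl
  | cons a w ih => simp [act, ih]

theorem act_bijective (M : MealyAutomaton Q X) (h : M.Invertible) (q : Q) :
    Function.Bijective (M.act q) := by
  constructor
  · intro u
    induction u generalizing q with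
    | nil =>
      intro v huv
      cases v with
      | nil => rfl
      | cons b v => simp [act] at huv
    | cons a u ih =>
      intro v huv
      cases v with
      | nil => simp [act] at huv
      | cons b v =>
        simp only [act, List.cons.injEq] at huv
        obtain ⟨h1, h2⟩ := huv
        have hab : a = b := (h q).1 h1
        subst hab
        rw [ih _ h2]
  · intro v
    induction v generalizing q with
    | nil => exact ⟨[], rfl⟩
    | cons b v ih =>
      obtain ⟨a, ha⟩ := (h q).2 b
      obtain ⟨u, hu⟩ := ih (M.trans q a)
      exact ⟨a :: u, by simp only [act, hu]; simpa using ha⟩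

theorem act_prefix_iff (M : MealyAutomaton Q X) (h : M.Invertible) (q : Q) (u v : List X) :
    u <+: v ↔ M.act q u <+: M.act q v := by
  induction u generalizing q v with
  | nil => simp [act]
  | cons a u ih =>
    cases v with
    | nil => simp [act]
    | cons b v =>
      simp only [act, List.cons_prefix_cons]
      constructor
      · rintro ⟨rfl, h2⟩
        exact ⟨rfl, (ih _ _).1 h2⟩
      · rintro ⟨h1, h2⟩
        have hab : a = b := (h q).1 h1
        subst hab
        exact ⟨rfl, (ih _ _).2 h2⟩

/-- The automorphism of the tree `List X` defined by a state of an invertible automaton. -/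
noncomputable def stateAut (M : MealyAutomaton Q X) (h : M.Invertible) (q : Q) : TreeAut X :=
  ⟨Equiv.ofBijective (M.act q) (M.act_bijective h q),
    fun w => M.length_act q w, fun u v => M.act_prefix_iff h q u v⟩

/-- The group `G(M)` generated by an invertible automaton. -/
def group (M : MealyAutomaton Q X) (h : M.Invertible) : Subgroup (TreeAut X) :=
  Subgroup.closure (Set.range (M.stateAut h))

/-- The generator of `G(M)` given by a state. -/
noncomputable def gen (M : MealyAutomaton Q X) (h : M.Invertible) (q : Q) : M.group h :=
  ⟨M.stateAut h q, Subgroup.subset_closure ⟨q, rfl⟩⟩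

/-- The element of `G(M)` represented by a positive word of states `q₁ q₂ ⋯ qₙ`, where `q₁` acts
first, then `q₂`, and so on. This is the order in which the dual automaton reads the word. -/
noncomputable def wordElt (M : MealyAutomaton Q X) (h : M.Invertible) : List Q → M.group h
  | [] => 1
  | q :: u => M.wordElt h u * M.gen h q

/-- The stabilizer in `G(M)` of a boundary point. -/
def stab (M : MealyAutomaton Q X) (h : M.Invertible) (ξ : InfWord X) : Subgroup (M.group h) :=
  MulAction.stabilizer (M.group h) ξ

/-- The positive stabilizer: the elements of the stabilizer that are represented by (possibly
empty) positive words of states. -/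
def posStab (M : MealyAutomaton Q X) (h : M.Invertible) (ξ : InfWord X) : Set (M.group h) :=
  Set.range (M.wordElt h) ∩ (M.stab h ξ : Set (M.group h))

/-- The positive relations: nonempty positive words of states that represent the identity. -/
def positiveRelations (M : MealyAutomaton Q X) (h : M.Invertible) : Set (List Q) :=
  {u | u ≠ [] ∧ M.wordElt h u = 1}

/-- Condition (TS) for an automaton `M`: for each nonempty word `u` over the alphabet, the positive
stabilizer of `u u u ⋯` in `G(M)` is nontrivial if and only if `u` has finite order in the group
generated by the dual automaton. -/
def ConditionTS (M : MealyAutomaton Q X) (h : M.IsRI) : Prop :=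
  ∀ (u : List X) (hu : u ≠ []),
    M.posStab h.invertible (InfWord.periodic u hu) ≠ {1} ↔
      ∃ l : ℕ, 1 ≤ l ∧ M.dual.wordElt h.dual.invertible u ^ l = 1

/-- The orbital graph of `G(M)` on the boundary, with respect to the generating set of states:
there is an edge `ξ → q ∘ ξ` with label `q` for each infinite word `ξ` and each state `q`. -/
def orbitalGraph (M : MealyAutomaton Q X) (h : M.Invertible) : LabelledDigraph (InfWord X) Q where
  edge ξ q η := M.gen h q • ξ = η

end MealyAutomaton

/-! All three statements amount to one condition (F): if `σ(v)` fixes `u^ω`, with `u` and `v`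
nonempty, then `π(u)` has finite order. Two facts link the automaton with its dual. The element
`π(u)` has finite order exactly when the orbit of `u^ω` under the dual group is finite
(`isOfFinOrder_iff_finite_orbit`). And if `σ(v)` fixes `u^ω`, then a positive power of `π(u)` fixes
`v^ω` (`exists_pow_smul_periodic_eq`).

The second fact derives (F) from (i). A positive relation of the dual would fix every `u^ω`, so
under (F) all positive words, hence all of `G(M)`, would be torsion; thus (F) excludes such
relations, and (TS) follows from the finiteness of orbits. A directed cycle in an orbital graph is a
point fixed by a nonempty word, and it can be traded for a periodic point of the same orbit
(`exists_fixed_periodic_of_mem_orbit`); this gives (iii).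

To return to (i), every state ends a word that commutes with a nonempty word
(`exists_commuting_words`), so (F) makes the inverses of states positive and every element of `G(M)`
is some `π(u)`. If `π(u)` fixes `ξ`, a repeated section of `u` along `ξ` has finite order by (F).
Its periodic word lies in the orbit of `u^ω`, so `π(u)` has finite order too. -/

/-! ### Infinite words -/

namespace InfWord

variable {X : Type*}

/-- The infinite word obtained by deleting the first `n` letters. -/
def shift (n : ℕ) (ξ : InfWord X) : InfWord X := fun i => ξ (n + i)

theorem pre_add (ξ : InfWord X) (m n : ℕ) : ξ.pre (m + n) = ξ.pre m ++ (shift m ξ).pre n := by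
  apply List.ext_getElem
  · simp
  · intro i h1 h2
    rw [getElem_pre, List.getElem_append]
    split_ifs with h
    · rw [getElem_pre]
    · rw [getElem_pre]
      simp only [length_pre] at h ⊢
      simp only [shift]
      congr 1
      omega

theorem pre_ne_nil (ξ : InfWord X) {n : ℕ} (h : 0 < n) : ξ.pre n ≠ [] := by
  rw [← List.length_pos_iff]
  simpa

theorem shift_mul_of_shift_eq {ξ : InfWord X} {n : ℕ} (h : shift n ξ = ξ) (k : ℕ) :
    shift (k * n) ξ = ξ := by
  induction k with
  | zero => funext i; simp [shift]
  | succ k ih =>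
    have : shift ((k + 1) * n) ξ = shift n (shift (k * n) ξ) := by
      funext i
      simp only [shift]
      congr 1
      ring
    rw [this, ih, h]

theorem shift_periodic (v : List X) (hv : v ≠ []) :
    shift v.length (periodic v hv) = periodic v hv := by
  funext i
  simp [shift, periodic]

theorem pre_length_periodic (v : List X) (hv : v ≠ []) : (periodic v hv).pre v.length = v := by
  apply List.ext_getElem
  · simp
  · intro i h1 h2
    rw [getElem_pre]
    simp [periodic, Nat.mod_eq_of_lt h2]

theorem eq_periodic_of_shift_eq {ξ : InfWord X} (v : List X) (hv : v ≠ [])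
    (h1 : shift v.length ξ = ξ) (h2 : ξ.pre v.length = v) : ξ = periodic v hv := by
  funext n
  have hlt := Nat.mod_lt n (List.length_pos_iff.mpr hv)
  have h3 := congrFun (shift_mul_of_shift_eq h1 (n / v.length)) (n % v.length)
  simp only [shift] at h3
  rw [mul_comm, Nat.div_add_mod] at h3
  rw [h3]
  have h4 : (ξ.pre v.length)[n % v.length]'(by simpa using hlt) = v[n % v.length] := by
    simp only [h2]
  rw [getElem_pre] at h4
  exact h4

/-- There are finitely many infinite words with a given positive period. -/
theorem finite_setOf_shift_eq [Finite X] {n : ℕ} (hn : 0 < n) :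
    {ξ : InfWord X | shift n ξ = ξ}.Finite := by
  refine Set.Finite.of_finite_image (f := fun ξ => ξ.pre n)
    ((List.finite_length_eq X n).subset ?_) ?_
  · rintro _ ⟨ξ, -, rfl⟩
    simp
  · intro ξ hξ η hη h
    have h1 := eq_periodic_of_shift_eq (ξ := ξ) (ξ.pre n) (ξ.pre_ne_nil hn) (by simpa using hξ)
      (by simp)
    have h2 := eq_periodic_of_shift_eq (ξ := η) (ξ.pre n) (ξ.pre_ne_nil hn) (by simpa using hη)
      (by rw [length_pre]; exact h.symm)
    rw [h1]
    exact h2.symm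

end InfWord

theorem exists_pow_smul_eq_of_finite {G α : Type*} [Group G] [MulAction G α] (g : G) (x : α)
    {s : Set α} (hs : s.Finite) (h : ∀ n : ℕ, g ^ n • x ∈ s) : ∃ k : ℕ, 1 ≤ k ∧ g ^ k • x = x := by
  obtain ⟨m, n, hmn, he⟩ := hs.exists_lt_map_eq_of_forall_mem h
  refine ⟨n - m, by omega, ?_⟩
  have : g ^ n = g ^ m * g ^ (n - m) := by rw [← pow_add]; congr 1; omega
  rw [this, mul_smul] at he
  exact (smul_left_cancel _ he).symm

namespace MealyAutomaton

open InfWord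

variable {Q X : Type*}

/-! ### Actions of words -/

/-- The action of a word of states on finite words; the first state acts first. -/
def actWord (M : MealyAutomaton Q X) (u : List Q) (w : List X) : List X :=
  u.foldl (fun w q => M.act q w) w

/-- The action of a word of states on letters; the first state acts first. -/
def outWord (M : MealyAutomaton Q X) (u : List Q) (a : X) : X :=
  u.foldl (fun a q => M.out q a) a

theorem length_actWord (M : MealyAutomaton Q X) (u : List Q) (w : List X) :
    (M.actWord u w).length = w.length := by
  induction u generalizing w with
  | nil => rfl
  | cons q u ih => exact (ih _).trans (M.length_act q w)

theorem actWord_ne_nil (M : MealyAutomaton Q X) (u : List Q) {w : List X} (hw : w ≠ []) :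
    M.actWord u w ≠ [] := by
  rw [← List.length_pos_iff, length_actWord]
  exact List.length_pos_iff.2 hw

theorem actWord_nil (M : MealyAutomaton Q X) (u : List Q) : M.actWord u [] = [] :=
  List.length_eq_zero_iff.1 (M.length_actWord u [])

theorem actWord_cons (M : MealyAutomaton Q X) (u : List Q) (a : X) (w : List X) :
    M.actWord u (a :: w) = M.outWord u a :: M.actWord (M.dual.act a u) w := by
  induction u generalizing a w with
  | nil => rfl
  | cons q u ih => exact ih (M.out q a) (M.act (M.trans q a) w)

/-- The duality underlying every computation below: after `u` has processed `v`, the section left to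
act on `w` is the image of `u` under the dual action of `v`. -/
theorem actWord_append (M : MealyAutomaton Q X) (u : List Q) (v w : List X) :
    M.actWord u (v ++ w) = M.actWord u v ++ M.actWord (M.dual.actWord v u) w := by
  induction v generalizing u with
  | nil => rw [actWord_nil]; rfl
  | cons a v ih =>
    rw [List.cons_append, actWord_cons, actWord_cons, ih]
    rfl

section Invertible

variable (M : MealyAutomaton Q X) (h : M.Invertible)

theorem coe_wordElt_apply (u : List Q) (w : List X) :
    (M.wordElt h u).1.1 w = M.actWord u w := by
  induction u generalizing w with
  | nil => rfl
  | cons q u ih => exact ih (M.act q w)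

theorem wordElt_singleton (q : Q) : M.wordElt h [q] = M.gen h q := one_mul _

theorem wordElt_append (u v : List Q) :
    M.wordElt h (u ++ v) = M.wordElt h v * M.wordElt h u := by
  induction u with
  | nil => exact (mul_one _).symm
  | cons q u ih => rw [List.cons_append, wordElt, wordElt, ih, mul_assoc]

theorem wordElt_replicate (q : Q) (k : ℕ) :
    M.wordElt h (List.replicate k q) = M.gen h q ^ k := by
  induction k with
  | zero => rfl
  | succ k ih => rw [List.replicate_succ, wordElt, ih, pow_succ]

theorem group_ext {g g' : M.group h} (H : ∀ w, g.1.1 w = g'.1.1 w) : g = g' :=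
  Subtype.ext (Subtype.ext (Equiv.ext H))

theorem wordElt_eq_iff {u v : List Q} :
    M.wordElt h u = M.wordElt h v ↔ ∀ w, M.actWord u w = M.actWord v w := by
  constructor
  · intro H w
    rw [← coe_wordElt_apply M h, H, coe_wordElt_apply]
  · intro H
    refine M.group_ext h fun w => ?_
    rw [coe_wordElt_apply, H, coe_wordElt_apply]

theorem wordElt_eq_one_iff {u : List Q} :
    M.wordElt h u = 1 ↔ ∀ w, M.actWord u w = w :=
  M.wordElt_eq_iff h (v := [])

theorem pre_wordElt_smul (u : List Q) (ξ : InfWord X) (n : ℕ) :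
    (M.wordElt h u • ξ).pre n = M.actWord u (ξ.pre n) :=
  (TreeAut.pre_bdry _ ξ n).trans (M.coe_wordElt_apply h u _)

theorem shift_wordElt_smul (u : List Q) (ξ : InfWord X) (n : ℕ) :
    shift n (M.wordElt h u • ξ) =
      M.wordElt h (M.dual.actWord (ξ.pre n) u) • shift n ξ := by
  refine ext_pre fun m => ?_
  have h1 := M.pre_wordElt_smul h u ξ (n + m)
  rw [pre_add, pre_add, actWord_append] at h1
  rw [(List.append_inj h1 (by simp [length_actWord])).2, pre_wordElt_smul]

theorem group_induction {P : M.group h → Prop} (one : P 1) (mul : ∀ g g', P g → P g' → P (g * g'))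
    (inv : ∀ g, P g → P g⁻¹) (gen : ∀ q, P (M.gen h q)) (g : M.group h) : P g := by
  obtain ⟨g, hg⟩ := g
  induction hg using Subgroup.closure_induction with
  | mem x hx =>
    obtain ⟨q, rfl⟩ := hx
    exact gen q
  | one => exact one
  | mul x y hx hy ihx ihy => exact mul _ _ ihx ihy
  | inv x hx ih => exact inv _ ih

/-! ### Positive words and inverses -/

/-- If the inverses of the generators are positive, then so are all elements. -/
theorem wordElt_surjective_of_inv (H : ∀ q, (M.gen h q)⁻¹ ∈ Set.range (M.wordElt h)) :
    Function.Surjective (M.wordElt h) := by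
  have hmul : ∀ g g', g ∈ Set.range (M.wordElt h) → g' ∈ Set.range (M.wordElt h) →
      g * g' ∈ Set.range (M.wordElt h) := by
    rintro _ _ ⟨u, rfl⟩ ⟨v, rfl⟩
    exact ⟨v ++ u, M.wordElt_append h v u⟩
  intro g
  refine (M.group_induction h
    (P := fun g => g ∈ Set.range (M.wordElt h) ∧ g⁻¹ ∈ Set.range (M.wordElt h))
    ⟨⟨[], rfl⟩, ⟨[], inv_one.symm⟩⟩ ?_ ?_ ?_ g).1
  · rintro g g' ⟨h1, h2⟩ ⟨h3, h4⟩
    rw [mul_inv_rev]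
    exact ⟨hmul _ _ h1 h3, hmul _ _ h4 h2⟩
  · rintro g ⟨h1, h2⟩
    rw [inv_inv]
    exact ⟨h2, h1⟩
  · exact fun q => ⟨⟨[q], M.wordElt_singleton h q⟩, H q⟩

theorem pow_mem_range_wordElt {g : M.group h} (hg : g ∈ Set.range (M.wordElt h)) (n : ℕ) :
    g ^ n ∈ Set.range (M.wordElt h) := by
  obtain ⟨u, rfl⟩ := hg
  induction n with
  | zero => exact ⟨[], rfl⟩
  | succ n ih =>
    obtain ⟨v, hv⟩ := ih
    exact ⟨u ++ v, by rw [wordElt_append, hv, pow_succ]⟩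

/-- If the last letter of a positive word of finite order is `q`, then the inverse of `q` is
positive. -/
theorem inv_gen_mem_range_of_isOfFinOrder {u : List Q} {q : Q}
    (hu : IsOfFinOrder (M.wordElt h (u ++ [q]))) : (M.gen h q)⁻¹ ∈ Set.range (M.wordElt h) := by
  obtain ⟨n, hn, h1⟩ := isOfFinOrder_iff_pow_eq_one.1 hu
  -- The last letter acts last, so the element of `u ++ [q]` is `gen q` times that of `u`.
  -- Cancelling this `gen q` in the `n`-th power leaves `u` performed after the power `n - 1`.
  obtain ⟨w, hw⟩ := M.pow_mem_range_wordElt h ⟨u ++ [q], rfl⟩ (n - 1)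
  refine ⟨w ++ u, ?_⟩
  rw [eq_inv_iff_mul_eq_one, ← mul_eq_one_comm, wordElt_append, hw, ← mul_assoc,
    ← wordElt_singleton, ← wordElt_append, ← pow_succ']
  rwa [Nat.sub_add_cancel hn]

/-- If all nonempty positive words have finite order, then the group is torsion. -/
theorem isOfFinOrder_of_forall_wordElt (H : ∀ u ≠ [], IsOfFinOrder (M.wordElt h u))
    (g : M.group h) : IsOfFinOrder g := by
  obtain ⟨u, rfl⟩ := M.wordElt_surjective_of_inv h
    (fun q => M.inv_gen_mem_range_of_isOfFinOrder h (u := []) (H [q] (by simp))) g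
  by_cases hu : u = []
  · subst hu
    exact IsOfFinOrder.one
  · exact H u hu

theorem exists_pow_wordElt_apply_eq [Finite X] (g : M.group h) (w : List X) :
    ∃ k : ℕ, 1 ≤ k ∧ (g ^ k).1.1 w = w := by
  obtain ⟨k, hk, h1⟩ := exists_pow_smul_eq_of_finite g.1.1 w
    (List.finite_length_eq X w.length) fun n => (g ^ n).1.2.1 w
  exact ⟨k, hk, h1⟩

/-- The word `u` meets each block `v` unchanged, hence acts block by block. -/
theorem wordElt_smul_periodic {u : List Q} {v : List X} (hv : v ≠ [])
    (huv : M.dual.actWord v u = u) :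
    M.wordElt h u • periodic v hv = periodic (M.actWord u v) (M.actWord_ne_nil u hv) := by
  apply eq_periodic_of_shift_eq
  · rw [length_actWord, shift_wordElt_smul, pre_length_periodic, huv, shift_periodic]
  · rw [length_actWord, pre_wordElt_smul, pre_length_periodic]

theorem wordElt_pre_mul_of_shift_eq (ξ : InfWord Q) {n : ℕ} (hξ : shift n ξ = ξ) (k : ℕ) :
    M.wordElt h (ξ.pre (k * n)) = M.wordElt h (ξ.pre n) ^ k := by
  induction k with
  | zero => rw [zero_mul]; rfl
  | succ k ih =>
    rw [Nat.succ_mul, add_comm, pre_add, hξ, wordElt_append, ih, pow_succ]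

theorem exists_wordElt_smul_eq_of_posStab_ne {ξ : InfWord X} (H : M.posStab h ξ ≠ {1}) :
    ∃ u ≠ [], M.wordElt h u • ξ = ξ := by
  by_contra! hc
  refine H (Set.eq_singleton_iff_unique_mem.2 ⟨⟨⟨[], rfl⟩, one_mem _⟩, ?_⟩)
  rintro _ ⟨⟨u, rfl⟩, hu⟩
  by_cases hu' : u = []
  · subst hu'
    rfl
  · exact absurd hu (hc u hu')

/-- Without positive relations a nonempty word is automatically a nontrivial element. -/
theorem posStab_ne_of_wordElt_smul_eq (hP : M.positiveRelations h = ∅) {ξ : InfWord X} {u : List Q}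
    (hu : u ≠ []) (H : M.wordElt h u • ξ = ξ) : M.posStab h ξ ≠ {1} := by
  intro h1
  have h2 : M.wordElt h u ∈ M.posStab h ξ := ⟨⟨u, rfl⟩, H⟩
  rw [h1] at h2
  have h3 : u ∈ M.positiveRelations h := ⟨hu, h2⟩
  rw [hP] at h3
  exact h3

/-! ### Sections -/

/-- The elements of `G(M)` are finite-state. -/
theorem exists_finite_sections [Finite Q] (g : M.group h) :
    ∃ s : Set (M.group h), s.Finite ∧
      ∀ (ξ : InfWord X) (n : ℕ), ∃ g' ∈ s, shift n (g • ξ) = g' • shift n ξ := by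
  refine M.group_induction h (P := fun g => ∃ s : Set (M.group h), s.Finite ∧
    ∀ (ξ : InfWord X) (n : ℕ), ∃ g' ∈ s, shift n (g • ξ) = g' • shift n ξ) ?_ ?_ ?_ ?_ g
  · exact ⟨{1}, Set.finite_singleton _, fun ξ n => ⟨1, rfl, by rw [one_smul, one_smul]⟩⟩
  · rintro g g' ⟨s, hs, H⟩ ⟨s', hs', H'⟩
    refine ⟨Set.image2 (· * ·) s s', hs.image2 _ hs', fun ξ n => ?_⟩
    obtain ⟨x', hx', e'⟩ := H' ξ n
    obtain ⟨x, hx, e⟩ := H (g' • ξ) n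
    exact ⟨x * x', Set.mem_image2_of_mem hx hx', by rw [mul_smul, mul_smul, e, e']⟩
  · rintro g ⟨s, hs, H⟩
    refine ⟨(·⁻¹) '' s, hs.image _, fun ξ n => ?_⟩
    obtain ⟨x, hx, e⟩ := H (g⁻¹ • ξ) n
    refine ⟨x⁻¹, ⟨x, hx, rfl⟩, ?_⟩
    rw [smul_inv_smul] at e
    rw [e, inv_smul_smul]
  · intro q
    refine ⟨Set.range (M.gen h), Set.finite_range _, fun ξ n => ?_⟩
    have h1 := M.shift_wordElt_smul h [q] ξ n
    obtain ⟨p, hp⟩ := List.length_eq_one_iff.1 (M.dual.length_actWord (ξ.pre n) [q])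
    rw [hp, wordElt_singleton, wordElt_singleton] at h1
    exact ⟨_, ⟨p, rfl⟩, h1⟩

/-! ### The orbital graph -/

theorem componentSet_orbitalGraph (ξ : InfWord X) :
    (M.orbitalGraph h).componentSet ξ = MulAction.orbit (M.group h) ξ := by
  ext η
  constructor
  · intro H
    induction H with
    | rel x y hxy =>
      obtain ⟨q, hq⟩ := hxy
      exact ⟨_, hq⟩
    | refl x => exact MulAction.mem_orbit_self x
    | symm x y _ ih => exact MulAction.mem_orbit_symm.1 ih
    | trans x y z _ _ ih1 ih2 =>
      rw [← MulAction.orbit_eq_iff] at ih1 ih2 ⊢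
      rw [ih2, ih1]
  · rintro ⟨g, rfl⟩
    refine M.group_induction h (P := fun g => ∀ ξ, Relation.EqvGen (M.orbitalGraph h).Adj ξ (g • ξ))
      ?_ ?_ ?_ ?_ g ξ
    · intro ξ
      rw [one_smul]
      exact .refl _
    · intro g g' h1 h2 ξ
      rw [mul_smul]
      exact .trans _ _ _ (h2 ξ) (h1 _)
    · intro g h1 ξ
      have := h1 (g⁻¹ • ξ)
      rw [smul_inv_smul] at this
      exact .symm _ _ this
    · exact fun q ξ => .rel _ _ ⟨q, rfl⟩

theorem isFinite_component_iff (ξ : InfWord X) :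
    ((M.orbitalGraph h).component ξ).IsFinite ↔ (MulAction.orbit (M.group h) ξ).Finite := by
  rw [← componentSet_orbitalGraph]
  exact Set.finite_coe_iff

theorem exists_wordElt_of_transGen {ξ : InfWord X} {x y : (M.orbitalGraph h).componentSet ξ}
    (H : Relation.TransGen ((M.orbitalGraph h).component ξ).Adj x y) :
    ∃ u ≠ [], M.wordElt h u • x.1 = y.1 := by
  induction H with
  | single hxy =>
    obtain ⟨q, hq⟩ := hxy
    exact ⟨[q], by simp, by rw [wordElt_singleton]; exact hq⟩
  | tail _ hyz ih =>
    obtain ⟨u, hu, e⟩ := ih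
    obtain ⟨q, hq⟩ := hyz
    refine ⟨u ++ [q], by simp, ?_⟩
    rw [wordElt_append, mul_smul, e, wordElt_singleton]
    exact hq

theorem transGen_of_wordElt {ξ : InfWord X} (u : List Q) (hu : u ≠ [])
    (x y : (M.orbitalGraph h).componentSet ξ) (e : M.wordElt h u • x.1 = y.1) :
    Relation.TransGen ((M.orbitalGraph h).component ξ).Adj x y := by
  induction u generalizing x with
  | nil => exact absurd rfl hu
  | cons q u ih =>
    have hz : M.gen h q • x.1 ∈ (M.orbitalGraph h).componentSet ξ :=
      .trans _ _ _ x.2 (.rel _ _ ⟨q, rfl⟩)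
    have hxz : ((M.orbitalGraph h).component ξ).Adj x ⟨_, hz⟩ := ⟨q, rfl⟩
    rw [wordElt, mul_smul] at e
    by_cases hu' : u = []
    · subst hu'
      have : (⟨_, hz⟩ : (M.orbitalGraph h).componentSet ξ) = y := by
        refine Subtype.ext ?_
        rw [← e]
        exact (one_smul _ _).symm
      exact .single (this ▸ hxz)
    · exact .head hxz (ih hu' ⟨_, hz⟩ e)

theorem not_isAcyclic_component {ξ : InfWord X} {u : List Q} (hu : u ≠ [])
    (e : M.wordElt h u • ξ = ξ) : ¬ ((M.orbitalGraph h).component ξ).IsAcyclic := fun H =>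
  H ⟨ξ, .refl _⟩ (M.transGen_of_wordElt h u hu _ _ e)

end Invertible

/-! ### Orders of words and orbits of periodic points -/

open scoped Pointwise

section RI

variable (M : MealyAutomaton Q X) (h : M.IsRI)

/-- Sections of a relation are relations, and a relation fixes every letter. So the sequences of
period `n` whose first `n` letters form a relation are a finite set invariant under the dual group.
-/
theorem finite_orbit_periodic_of_isOfFinOrder [Finite Q] {u : List Q} (hu : u ≠ [])
    (H : IsOfFinOrder (M.wordElt h.invertible u)) :
    (MulAction.orbit (M.dual.group h.dual.invertible) (periodic u hu)).Finite := by
  obtain ⟨l, hl, h1⟩ := isOfFinOrder_iff_pow_eq_one.1 H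
  set n := l * u.length with hn
  have hn0 : 0 < n := Nat.mul_pos hl (List.length_pos_iff.2 hu)
  set s : Set (InfWord Q) := {η | shift n η = η ∧ M.wordElt h.invertible (η.pre n) = 1} with hs
  have hfin : s.Finite := (finite_setOf_shift_eq hn0).subset fun η hη => hη.1
  have hus : periodic u hu ∈ s := by
    refine ⟨shift_mul_of_shift_eq (shift_periodic u hu) l, ?_⟩
    rw [hn, wordElt_pre_mul_of_shift_eq _ _ _ (shift_periodic u hu), pre_length_periodic, h1]
  have hgen : ∀ a, ∀ η ∈ s, M.dual.gen h.dual.invertible a • η ∈ s := by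
    rintro a η ⟨h2, h3⟩
    rw [← wordElt_singleton]
    rw [wordElt_eq_one_iff] at h3
    refine ⟨?_, ?_⟩
    · rw [shift_wordElt_smul, h2]
      congr 2
      exact h3 [a]
    · rw [wordElt_eq_one_iff, pre_wordElt_smul]
      intro w
      have h4 := h3 (a :: w)
      rw [actWord_cons] at h4
      exact (List.cons.inj h4).2
  have hstab (g) : g ∈ MulAction.stabilizer (M.dual.group h.dual.invertible) s := by
    refine M.dual.group_induction h.dual.invertible (P := fun g => g ∈ MulAction.stabilizer _ s)
      (one_mem _) (fun _ _ => mul_mem) (fun _ => inv_mem) (fun a => ?_) g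
    rw [MulAction.mem_stabilizer_set_iff_smul_set_subset hfin]
    rintro _ ⟨η, hη, rfl⟩
    exact hgen a η hη
  refine hfin.subset ?_
  rintro _ ⟨g, rfl⟩
  exact (MulAction.mem_stabilizer_set.1 (hstab g) _).2 hus

/-- Pigeonhole on the maps on letters induced by prefixes, taken simultaneously over the whole
finite orbit. Since sections stay in the orbit, agreement on letters propagates to agreement on all
words. -/
theorem isOfFinOrder_of_finite_orbit_periodic [Finite X] {u : List Q} (hu : u ≠ [])
    (H : (MulAction.orbit (M.dual.group h.dual.invertible) (periodic u hu)).Finite) :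
    IsOfFinOrder (M.wordElt h.invertible u) := by
  set O := MulAction.orbit (M.dual.group h.dual.invertible) (periodic u hu) with hO
  have : Finite O := H
  obtain ⟨j, k, hjk, e⟩ := Finite.exists_ne_map_eq_of_infinite
    fun (j : ℕ) (η : O) => M.outWord (η.1.pre (j * u.length))
  have key : ∀ (w : List X), ∀ η ∈ O, M.actWord (η.pre (j * u.length)) w =
      M.actWord (η.pre (k * u.length)) w := by
    intro w
    induction w with
    | nil => intro η _; rw [actWord_nil, actWord_nil]
    | cons a w ih =>
      intro η hη
      have h1 : M.dual.wordElt h.dual.invertible [a] • η ∈ O := by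
        obtain ⟨g, rfl⟩ := hη
        rw [smul_smul]
        exact ⟨_, rfl⟩
      have h2 := ih _ h1
      rw [pre_wordElt_smul, pre_wordElt_smul] at h2
      rw [actWord_cons, actWord_cons, congrFun (congrFun e ⟨η, hη⟩) a]
      exact congrArg _ h2
  have h1 : M.wordElt h.invertible u ^ j = M.wordElt h.invertible u ^ k := by
    have h2 := (M.wordElt_eq_iff h.invertible).2
      fun w => key w _ (MulAction.mem_orbit_self (periodic u hu))
    rwa [wordElt_pre_mul_of_shift_eq _ _ _ (shift_periodic u hu),
      wordElt_pre_mul_of_shift_eq _ _ _ (shift_periodic u hu), pre_length_periodic] at h2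
  by_contra hc
  exact hjk (injective_pow_iff_not_isOfFinOrder.2 hc h1)

/-! ### Commuting words and fixed periodic points -/

/-- If `v` fixes `u u u ⋯`, then a power of `u` fixes `v v v ⋯`. -/
theorem exists_pow_smul_periodic_eq [Finite X] {u : List Q} (hu : u ≠ []) {v : List X}
    (hv : v ≠ [])
    (H : M.dual.wordElt h.dual.invertible v • periodic u hu = periodic u hu) :
    ∃ k : ℕ, 1 ≤ k ∧ M.wordElt h.invertible u ^ k • periodic v hv = periodic v hv := by
  have key : ∀ k : ℕ, ∃ (w : List X) (hw : w ≠ []), (M.wordElt h.invertible u ^ k).1.1 v = w ∧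
      M.wordElt h.invertible u ^ k • periodic v hv = periodic w hw ∧
      M.dual.wordElt h.dual.invertible w • periodic u hu = periodic u hu := by
    intro k
    induction k with
    | zero => exact ⟨v, hv, rfl, by rw [pow_zero, one_smul], H⟩
    | succ k ih =>
      obtain ⟨w, hw, h1, h2, h3⟩ := ih
      have h4 : M.dual.actWord w u = u := by
        rw [← pre_length_periodic u hu, ← pre_wordElt_smul _ h.dual.invertible, h3]
      refine ⟨M.actWord u w, M.actWord_ne_nil u hw, ?_, ?_, ?_⟩
      · rw [← coe_wordElt_apply _ h.invertible, ← h1, pow_succ']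
        rfl
      · rw [pow_succ', mul_smul, h2, wordElt_smul_periodic _ _ _ h4]
      -- Deleting one block `u` from the fixed word `u^ω` replaces `w` by its section, the image of
      -- `w` under `u`, which therefore fixes `u^ω` again.
      · have h5 := M.dual.shift_wordElt_smul h.dual.invertible w (periodic u hu) u.length
        rw [h3, shift_periodic, pre_length_periodic] at h5
        exact h5.symm
  obtain ⟨k, hk, h1⟩ := M.exists_pow_wordElt_apply_eq h.invertible
    (M.wordElt h.invertible u) v
  obtain ⟨w, hw, h2, h3, -⟩ := key k
  refine ⟨k, hk, ?_⟩
  rw [h3]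
  congr 1
  rw [← h2, h1]

/-- If `u` fixes a boundary point, then some section of `u` at a word fixed by `u` commutes with a
nonempty word. -/
theorem exists_section_of_wordElt_smul_eq [Finite Q] {u : List Q} {ξ : InfWord X}
    (H : M.wordElt h.invertible u • ξ = ξ) :
    ∃ w v : List X, v ≠ [] ∧ M.actWord u w = w ∧
      M.actWord (M.dual.actWord w u) v = v ∧
      M.dual.actWord v (M.dual.actWord w u) = M.dual.actWord w u := by
  -- The sections of `u` along `ξ` are words of length `u.length`, so two coincide; `v` is the
  -- stretch of `ξ` between them.
  obtain ⟨m, n, hmn, e⟩ := (List.finite_length_eq Q u.length).exists_lt_map_eq_of_forall_mem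
    (f := fun n => M.dual.actWord (ξ.pre n) u) fun n => M.dual.length_actWord _ _
  obtain ⟨k, rfl⟩ := Nat.exists_eq_add_of_lt hmn
  refine ⟨ξ.pre m, (shift m ξ).pre (k + 1), pre_ne_nil _ k.succ_pos, ?_, ?_, ?_⟩
  · rw [← pre_wordElt_smul _ h.invertible, H]
  · rw [← pre_wordElt_smul _ h.invertible, ← shift_wordElt_smul, H]
  · simp only [add_assoc, pre_add ξ m (k + 1)] at e
    refine Eq.trans ?_ e.symm
    simp only [actWord, List.foldl_append]

/-- Every state is the last letter of a word that commutes with a nonempty word. -/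
theorem exists_commuting_words (M : MealyAutomaton Q X) (h : M.IsRI) [Finite Q] [Finite X] [Nonempty X] (q : Q) :
    ∃ (u : List Q) (v : List X), v ≠ [] ∧ M.actWord (u ++ [q]) v = v ∧
      M.dual.actWord v (u ++ [q]) = u ++ [q] := by
  obtain ⟨b⟩ := ‹Nonempty X›
  choose r hr using fun q b => (h.invertible q).2 b
  -- Here `r p c` is the input on which `p` outputs `c`. The map passes to the target state and
  -- takes this input as the next output to be produced; reversibility makes it injective, so its
  -- orbits are cycles.
  set f : Q × X → Q × X := fun p => (M.trans p.1 (r p.1 p.2), r p.1 p.2) with hf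
  have hinj : Function.Injective f := by
    rintro ⟨p, c⟩ ⟨p', c'⟩ e
    obtain ⟨e1, e2⟩ := Prod.ext_iff.1 e
    simp only [hf] at e1 e2
    rw [← e2] at e1
    have e3 := (h.reversible _).1 e1
    have e4 := hr p c
    have e5 := hr p' c'
    subst e3
    rw [← e2] at e5
    exact Prod.ext rfl (e4.symm.trans e5)
  obtain ⟨n, hn, hp⟩ := hinj.mem_periodicPts (q, b)
  set H : ℕ → Q := fun k => (f^[k] (q, b)).1 with hH
  set W : InfWord X := fun k => (f^[k] (q, b)).2 with hW
  have hsucc (k : ℕ) : H (k + 1) = M.trans (H k) (W (k + 1)) ∧ M.out (H k) (W (k + 1)) = W k := by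
    simp only [hH, hW, Function.iterate_succ_apply', hf]
    exact ⟨trivial, hr _ _⟩
  have hper (k : ℕ) : f^[k + n] (q, b) = f^[k] (q, b) := by
    rw [Function.iterate_add_apply, hp.eq]
  have hcons (k i : ℕ) : (shift i W).pre (k + 1) = W i :: (shift (i + 1) W).pre k := by
    rw [add_comm k 1, pre_add]
    simp only [pre, List.ofFn_succ, List.ofFn_zero, shift]
    simp [add_comm, add_left_comm]
  -- Along the cycle, the state `H i` acts on the letters as a backward shift.
  have hact (k i : ℕ) : M.act (H i) ((shift (i + 1) W).pre k) = (shift i W).pre k := by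
    induction k generalizing i with
    | zero => rfl
    | succ k ih =>
      rw [hcons, hcons, act, (hsucc i).2, ← (hsucc i).1, ih]
  have htrans (k i : ℕ) : M.dual.actWord ((shift (i + 1) W).pre k) [H i] = [H (i + k)] := by
    induction k generalizing i with
    | zero => rfl
    | succ k ih =>
      rw [hcons]
      refine Eq.trans ?_ ((ih (i + 1)).trans (by rw [add_right_comm, add_assoc]))
      rw [(hsucc i).1]
      rfl
  -- The order is reversed so that each state undoes one shift in turn and `H 0 = q` acts last; a
  -- full period of shifts is trivial.
  set U : ℕ → List Q := fun k => ((List.range k).map H).reverse with hU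
  have hUsucc (k : ℕ) : U (k + 1) = H k :: U k := by
    simp [hU, List.range_succ]
  have h1 (k : ℕ) : M.actWord (U k) ((shift k W).pre n) = (shift 0 W).pre n ∧
      M.dual.actWord ((shift k W).pre n) (U k) = U k := by
    induction k with
    | zero => exact ⟨rfl, M.dual.actWord_nil _⟩
    | succ k ih =>
      rw [hUsucc]
      have h2 : M.actWord (H k :: U k) ((shift (k + 1) W).pre n) =
          M.actWord (U k) (M.act (H k) ((shift (k + 1) W).pre n)) := rfl
      have h3 := M.dual.actWord_append ((shift (k + 1) W).pre n) [H k] (U k)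
      have h4 : M.dual.dual.actWord [H k] ((shift (k + 1) W).pre n) =
          M.act (H k) ((shift (k + 1) W).pre n) := rfl
      rw [h4, hact, htrans, ih.2] at h3
      rw [h2, hact]
      refine ⟨ih.1, h3.trans ?_⟩
      simp only [hH, hper]
      rfl
  have h2 : shift n W = shift 0 W := by
    funext i
    simp only [shift, hW]
    rw [add_comm n, hper, zero_add]
  obtain ⟨m, rfl⟩ := Nat.exists_eq_add_of_lt hn
  have h3 : U (0 + m + 1) = ((List.range m).map fun k => H (k + 1)).reverse ++ [q] := by
    simp [hU, List.range_succ_eq_map, hH, Function.comp_def]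
  have h4 := h1 (0 + m + 1)
  rw [h2, h3] at h4
  exact ⟨_, _, pre_ne_nil _ hn, h4.1, h4.2⟩

/-- Because `u` fixes `w`, the dual element of `w` acts block by block on `u^ω` and produces the
periodic word of the section. -/
theorem orbit_periodic_actWord {u : List Q} (hu : u ≠ []) {w : List X} (hw : M.actWord u w = w) :
    MulAction.orbit (M.dual.group h.dual.invertible)
      (periodic (M.dual.actWord w u) (M.dual.actWord_ne_nil w hu)) =
    MulAction.orbit (M.dual.group h.dual.invertible) (periodic u hu) := by
  rw [← M.dual.wordElt_smul_periodic h.dual.invertible hu hw, MulAction.orbit_smul]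

theorem isOfFinOrder_iff_finite_orbit [Finite Q] [Finite X] {u : List Q} (hu : u ≠ []) :
    IsOfFinOrder (M.wordElt h.invertible u) ↔
      (MulAction.orbit (M.dual.group h.dual.invertible) (periodic u hu)).Finite :=
  ⟨M.finite_orbit_periodic_of_isOfFinOrder h hu, M.isOfFinOrder_of_finite_orbit_periodic h hu⟩

/-- If a nonempty positive word fixes a point in the orbit of `u u u ⋯`, then a nonempty positive
word fixes a periodic point in this orbit. -/
theorem exists_fixed_periodic_of_mem_orbit [Finite X] {u : List Q} (hu : u ≠ [])
    {η : InfWord Q}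
    (hη : η ∈ MulAction.orbit (M.dual.group h.dual.invertible) (periodic u hu))
    {v : List X} (hv : v ≠ []) (hfix : M.dual.wordElt h.dual.invertible v • η = η) :
    ∃ (y : List Q) (hy : y ≠ []) (v' : List X), v' ≠ [] ∧
      periodic y hy ∈ MulAction.orbit (M.dual.group h.dual.invertible) (periodic u hu) ∧
      M.dual.wordElt h.dual.invertible v' • periodic y hy = periodic y hy := by
  obtain ⟨g, rfl⟩ := hη
  simp only at hfix
  -- Each tail of `g • u^ω` after whole blocks is a section of `g` applied to `u^ω`. Finitely many
  -- sections occur, so the sequence is eventually periodic with tails in the orbit.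
  obtain ⟨s, hs, H⟩ := M.dual.exists_finite_sections h.dual.invertible g
  choose g' hg' e using fun n => H (periodic u hu) (n * u.length)
  simp only [shift_mul_of_shift_eq (shift_periodic u hu)] at e
  obtain ⟨i, j, hij, eij⟩ := hs.exists_lt_map_eq_of_forall_mem hg'
  obtain ⟨k, rfl⟩ := Nat.exists_eq_add_of_lt hij
  set η := g • periodic u hu with hη
  set m := u.length with hm
  have hm0 : 0 < m := List.length_pos_iff.2 hu
  have hpos : 0 < (k + 1) * m := Nat.mul_pos k.succ_pos hm0
  set ζ := shift (i * m) η with hζ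
  have hper : shift ((k + 1) * m) ζ = ζ := by
    have h1 : shift ((i + k + 1) * m) η = ζ := by rw [hζ, e, e, eij]
    rw [← h1, h1, hζ]
    refine Eq.trans ?_ h1
    funext l
    simp only [shift]
    congr 1
    ring
  have hy := ζ.pre_ne_nil hpos
  have h1 : ζ = periodic (ζ.pre ((k + 1) * m)) hy :=
    eq_periodic_of_shift_eq _ hy (by rw [length_pre, hper]) (by rw [length_pre])
  refine ⟨_, hy, M.actWord (η.pre (i * m)) v, M.actWord_ne_nil _ hv, ?_, ?_⟩
  · rw [← h1, hζ, e]
    exact ⟨_, rfl⟩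
  · rw [← h1]
    have h2 := M.dual.shift_wordElt_smul h.dual.invertible v η (i * m)
    rw [hfix] at h2
    exact h2.symm

end RI

end MealyAutomaton

/-! ### The equivalence -/

open MealyAutomaton InfWord

theorem mainTheorem9 {Q X : Type*} [Finite Q] [Finite X] (M : MealyAutomaton Q X)
    (hM : M.IsBireversible)
    (hinf : Infinite (M.group hM.invertible))
    (hap : ∃ g : M.group hM.invertible, ¬ IsOfFinOrder g) :
    List.TFAE [
      ∀ ξ : InfWord X, IsMulTorsion (M.stab hM.invertible ξ),
      M.dual.positiveRelations hM.toIsRI.dual.invertible = ∅ ∧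
        M.dual.ConditionTS hM.toIsRI.dual,
      ∀ (v : List Q) (hv : v ≠ []),
        ((M.dual.orbitalGraph hM.toIsRI.dual.invertible).component
            (InfWord.periodic v hv)).IsFinite ∨
        ((M.dual.orbitalGraph hM.toIsRI.dual.invertible).component
            (InfWord.periodic v hv)).IsAcyclic] := by
  have h : M.IsRI := hM.toIsRI
  obtain ⟨a⟩ : Nonempty X := by
    by_contra hX
    rw [not_nonempty_iff] at hX
    obtain ⟨g, hg⟩ := hap
    refine hg ?_
    have : g = 1 := M.group_ext _ fun w => Subsingleton.elim _ _
    rw [this]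
    exact IsOfFinOrder.one
  have : Nonempty X := ⟨a⟩
  have hord (u : List Q) : (∃ l : ℕ, 1 ≤ l ∧ M.wordElt h.invertible u ^ l = 1) ↔
      IsOfFinOrder (M.wordElt h.invertible u) := isOfFinOrder_iff_pow_eq_one.symm
  have hnot : ¬ ∀ u ≠ [], IsOfFinOrder (M.wordElt h.invertible u) := fun H => by
    obtain ⟨g, hg⟩ := hap
    exact hg (M.isOfFinOrder_of_forall_wordElt _ H g)
  -- The hypothesis `H`, here and in `hP`, is condition (F).
  have hTS (hP : M.dual.positiveRelations h.dual.invertible = ∅)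
      (H : ∀ (u : List Q) (hu : u ≠ []) (v : List X), v ≠ [] →
        M.dual.wordElt h.dual.invertible v • periodic u hu = periodic u hu →
        IsOfFinOrder (M.wordElt h.invertible u)) :
      M.dual.ConditionTS h.dual := by
    intro u hu
    refine Iff.trans ⟨fun h1 => ?_, fun h1 => ?_⟩ (hord u).symm
    · obtain ⟨v, hv, e⟩ := M.dual.exists_wordElt_smul_eq_of_posStab_ne _ h1
      exact H u hu v hv e
    -- Any letter will do: its powers keep `u^ω` inside a finite orbit, so one of them fixes it.
    · obtain ⟨k, hk, e⟩ := exists_pow_smul_eq_of_finite (M.dual.gen h.dual.invertible a)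
        (periodic u hu) (M.finite_orbit_periodic_of_isOfFinOrder h hu h1) fun n => ⟨_, rfl⟩
      rw [← wordElt_replicate] at e
      refine M.dual.posStab_ne_of_wordElt_smul_eq _ hP ?_ e
      rw [← List.length_pos_iff, List.length_replicate]
      exact hk
  have hP (H : ∀ (u : List Q) (hu : u ≠ []) (v : List X), v ≠ [] →
        M.dual.wordElt h.dual.invertible v • periodic u hu = periodic u hu →
        IsOfFinOrder (M.wordElt h.invertible u)) :
      M.dual.positiveRelations h.dual.invertible = ∅ := by
    rw [Set.eq_empty_iff_forall_notMem]
    rintro v ⟨hv, hv1⟩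
    exact hnot fun u hu => H u hu v hv (by rw [hv1, one_smul])
  have hfin (H : M.dual.positiveRelations h.dual.invertible = ∅ ∧ M.dual.ConditionTS h.dual)
      (u : List Q) (hu : u ≠ []) (v : List X) (hv : v ≠ [])
      (e : M.dual.wordElt h.dual.invertible v • periodic u hu = periodic u hu) :
      IsOfFinOrder (M.wordElt h.invertible u) :=
    (hord u).1 ((H.2 u hu).1 (M.dual.posStab_ne_of_wordElt_smul_eq _ H.1 hv e))
  tfae_have 1 → 2 := by
    intro H
    have H' (u : List Q) (hu : u ≠ []) (v : List X) (hv : v ≠ [])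
        (e : M.dual.wordElt h.dual.invertible v • periodic u hu = periodic u hu) :
        IsOfFinOrder (M.wordElt h.invertible u) := by
      obtain ⟨k, hk, e1⟩ := M.exists_pow_smul_periodic_eq h hu hv e
      have h1 := (Subgroup.subtype_injective _).isOfFinOrder_iff.2 (H (periodic v hv) ⟨_, e1⟩)
      exact IsOfFinOrder.of_pow h1 (by omega)
    exact ⟨hP H', hTS (hP H') H'⟩
  tfae_have 2 → 3 := by
    intro H u hu
    rw [isFinite_component_iff, or_iff_not_imp_right]
    intro hc
    rw [LabelledDigraph.IsAcyclic] at hc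
    push Not at hc
    obtain ⟨x, hx⟩ := hc
    obtain ⟨v, hv, e⟩ := M.dual.exists_wordElt_of_transGen _ hx
    have hx' := (M.dual.componentSet_orbitalGraph h.dual.invertible (periodic u hu)).subset x.2
    -- The cycle may pass through a point that is not periodic, where (F) says nothing.
    obtain ⟨y, hy, v', hv', h1, h2⟩ := M.exists_fixed_periodic_of_mem_orbit h hu hx' hv e
    have h3 := (M.isOfFinOrder_iff_finite_orbit h hy).1 (hfin H y hy v' hv' h2)
    rwa [MulAction.orbit_eq_iff.2 h1] at h3
  tfae_have 3 → 2 := by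
    intro H
    have H' (u : List Q) (hu : u ≠ []) (v : List X) (hv : v ≠ [])
        (e : M.dual.wordElt h.dual.invertible v • periodic u hu = periodic u hu) :
        IsOfFinOrder (M.wordElt h.invertible u) := by
      rw [M.isOfFinOrder_iff_finite_orbit h hu, ← isFinite_component_iff]
      exact (H u hu).resolve_right (M.dual.not_isAcyclic_component _ hv e)
    exact ⟨hP H', hTS (hP H') H'⟩
  tfae_have 2 → 1 := by
    intro H ξ
    -- Condition (F) only concerns positive words, so all of `G(M)` must first be shown positive.
    have hsurj : Function.Surjective (M.wordElt h.invertible) := by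
      refine M.wordElt_surjective_of_inv _ fun q => ?_
      obtain ⟨u, v, hv, h1, h2⟩ := M.exists_commuting_words h q
      refine M.inv_gen_mem_range_of_isOfFinOrder _ (hfin H (u ++ [q]) (by simp) v hv ?_)
      rw [M.dual.wordElt_smul_periodic _ _ h1]
      congr 1
    rintro ⟨g, hg⟩
    refine (Subgroup.subtype_injective _).isOfFinOrder_iff.1 ?_
    change IsOfFinOrder g
    obtain ⟨u, rfl⟩ := hsurj g
    by_cases hu : u = []
    · subst hu
      exact IsOfFinOrder.one
    obtain ⟨w, v, hv, h1, h2, h3⟩ := M.exists_section_of_wordElt_smul_eq h hg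
    have hwu := M.dual.actWord_ne_nil w hu
    have h4 := hfin H _ hwu v hv (by
      rw [M.dual.wordElt_smul_periodic _ _ h2]
      congr 1)
    -- Finite order passes from the section back to `u` because their periodic words share an orbit.
    rw [M.isOfFinOrder_iff_finite_orbit h hwu, M.orbit_periodic_actWord h hu h1] at h4
    exact (M.isOfFinOrder_iff_finite_orbit h hu).2 h4
  tfae_finish
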